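/- **Setting.** Let $\Lambda$ be a set of unary modal operators with an involution $\heartsuit\mapsto\overline\heartsuit$ (duals), $F\colon\mathsf{Set}\to\mathsf{Set}$ a functor, and let each $\heartsuit\in\Lambda$ be interpreted by a monotone predicate lifting, i.e. by maps $[\![\heartsuit]\!]_U\colon\mathcal P(U)\to\mathcal P(FU)$ that are monotone and natural ($[\![\heartsuit]\!]_U(f^{-1}[Z])=(Ff)^{-1}[[\![\heartsuit]\!]_V(Z)]$ for $f\colon U\to V$), with $[\![\overline\heartsuit]\!]_U(A)=FU\setminus[\![\heartsuit]\!]_U(U\setminus A)$. Formulae are given by $$\phi::=\bot\mid\top\mid\phi\wedge\phi\mid\phi\vee\phi\mid\heartsuit\phi\mid X\mid\neg X\mid\mu X.\,\phi\mid\nu X.\,\phi,$$ where $\neg X$ may not occur in the scope of $\mu X$ or $\nu X$. Let $\chi$ be a closed formula in which each variable is bound by at most one fixpoint operator; let $n_0=|\chi|$ be its length (number of symbols). For a bound variable $X$ of $\chi$ let $\theta(X)$ be the subformula $\eta X.\,\psi$ of $\chi$. A dependency chain is a sequence $X_0,\dots,X_n$ of bound variables such that $\theta(X_{i+1})$ is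 a subformula of $\theta(X_i)$ and $X_i$ is free in $\theta(X_{i+1})$ for all $i<n$; its alternation number is $1$ plus the number of $i<n$ such that one of $X_i,X_{i+1}$ is bound by $\mu$ and the other by $\nu$. Let $\mathsf{ad}(X)$ be the maximal alternation number of dependency chains with $X_0=X$, and let $k=\max_X\mathsf{ad}(X)$, or $k=1$ if $\chi$ contains no fixpoint operators. **Tracking automaton.** Let $\mathbf F$ be the Fischer-Ladner closure of $\chi$, i.e. the least set of formulae containing $\chi$ and closed under passing from $\phi\wedge\psi$ and $\phi\vee\psi$ to $\phi,\psi$, from $\heartsuit\phi$ to $\phi$, and from $\eta X.\,\phi$ to $\phi[\eta X.\,\phi/X]$. A *choice* is a function $\tau$ that maps every disjunction in $\mathbf F$ to one of its disjuncts; a *selection* is a set $\kappa$ of formulae of the form $\heartsuit\psi$ in $\mathbf F$. Let $\Sigma$ be the disjoint union of the sets $\mathsf{choices}$ and $\mathsf{selections}$. The tracking automaton $\mathsf A_\chi$ is the nondeterministic parity automaton with states $\mathbf F$, initial state $\chi$, alphabet $\Sigma$, and transitions $\Delta(\psi_1\vee\psi_2,\tau)=\{\tau(\psi_1\vee\psi_2)\}$,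 $\Delta(\psi_1\wedge\psi_2,\tau)=\{\psi_1,\psi_2\}$, $\Delta(\eta X.\,\psi,\tau)=\{\psi[\eta X.\,\psi/X]\}$, $\Delta(\heartsuit\psi,\tau)=\{\heartsuit\psi\}$, $\Delta(\top,\tau)=\Delta(\bot,\tau)=\emptyset$, $\Delta(\psi,\kappa)=\{\psi_0\}$ if $\psi=\heartsuit\psi_0\in\kappa$, and $\Delta(\psi,\kappa)=\emptyset$ otherwise; the priority of $\mu X.\,\phi$ is $2\,\mathsf{ad}(X)$, that of $\nu X.\,\phi$ is $2\,\mathsf{ad}(X)-1$, and that of every other formula is $1$. A parity automaton accepts an infinite word if it has a run on it on which the highest priority occurring infinitely often is even. Let $\mathsf B_\chi=(D_\chi,\Sigma,\delta,q_{\mathsf{init}},\Omega)$ be a co-determinized tracking automaton: a finite deterministic parity automaton (with total transition function $\delta\colon D_\chi\times\Sigma\to D_\chi$) with priorities $\Omega(q)\in\{1,\dots,2n_0k\}$ and $L(\mathsf B_\chi)=\Sigma^\omega\setminus L(\mathsf A_\chi)$, equipped with a labelling $l\colon D_\chi\to\mathcal P(\mathbf F)$ such that $l(q_{\mathsf{init}})=\{\chi\}$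 and $l(\delta(q,a))=\bigcup_{\psi\in l(q)}\Delta(\psi,a)$ for all $q\in D_\chi$, $a\in\Sigma$. **One-step satisfiability.** For $\Theta\subseteq\mathcal P(\mathbf F)$, $\psi\in\mathbf F$ and a set $\gamma$ of formulae $\heartsuit\psi$ with $\psi\in\mathbf F$, put $[\![\psi]\!]_0^\Theta=\{u\in\Theta\mid\psi\in u\}$ and $[\![\gamma]\!]_1^\Theta=\bigcap_{\heartsuit\psi\in\gamma}[\![\heartsuit]\!]_\Theta([\![\psi]\!]_0^\Theta)\subseteq F\Theta$. Let $\gamma_q$ be the set of formulae of the form $\heartsuit\psi$ in $l(q)$. **Fixpoint.** For $X_1,\dots,X_{2n_0k}\subseteq D_\chi$ let $f(X_1,\dots,X_{2n_0k})$ be the set of all $q\in D_\chi$ such that $[\![\gamma_q]\!]_1^{\Theta}\neq\emptyset$ for $\Theta=l[\{\delta(q,\kappa)\mid\kappa\in\mathsf{selections}\}\cap X_{\Omega(q)}]$, $\bot\notin l(q)$, and $\delta(q,\tau)\in X_{\Omega(q)}$ for some $\tau\in\mathsf{choices}$. Put $$\mathbf E=\eta_{2n_0k}X_{2n_0k}.\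 \ldots\ \eta_1X_1.\ f(X_1,\dots,X_{2n_0k}),$$ where $\eta_i=\mu$ (least fixpoint) for odd $i$ and $\eta_i=\nu$ (greatest fixpoint) for even $i$. **Satisfiability game.** The parity game $\mathsf G_\chi$ has the following nodes and moves, for $q\in D_\chi$ and $\Xi\subseteq\mathsf{selections}$. - $q$ belongs to $\forall$, has priority $\Omega(q)$, and has moves to $(q,0)$ and $(q,1)$. - $(q,0)$ belongs to $\exists$, has priority $0$, and has moves to $\delta(q,\tau)$ for all $\tau\in\mathsf{choices}$ if $\bot\notin l(q)$, and no moves otherwise. - $(q,1)$ belongs to $\exists$, has priority $0$, and has moves to all $(q,\Xi)$ with $[\![\gamma_q]\!]_1^{\Theta}\neq\emptyset$ for $\Theta=l[\{\delta(q,\kappa)\mid\kappa\in\Xi\}]$. - $(q,\Xi)$ belongs to $\forall$, has priority $0$, and has moves to $\delta(q,\kappa)$ for all $\kappa\in\Xi$. A player who is stuck loses; an infinite play is won by $\exists$ iff the highest priority visited infinitely often is even; $\exists$ wins a node if she has a (possibly history-dependent) strategy such that she wins every maximal play that starts at this node and follows the strategy. **Lemma.** For all $q\in D_\chi$, we have $q\in\mathbf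 E$ if and only if the existential player wins the node $q$ in $\mathsf G_\chi$. -/

import Mathlib

open CategoryTheory

universe u w

namespace CoalgMu

/-! ### Coalgebraic logics -/

/-- A monotone unary predicate lifting for a set functor `F`: a natural transformation from the
contravariant powerset functor `Q` to `Q ∘ Fᵒᵖ`, written out, all of whose components are
monotone. -/
structure PredLifting (F : Type u ⥤ Type u) where
  app : (U : Type u) → Set U → Set (F.obj U)
  natural : ∀ {U V : Type u} (f : U → V) (Z : Set V),
    app U (f ⁻¹' Z) = (fun t => F.map (TypeCat.ofHom f) t) ⁻¹' app V Z
  mono : ∀ (U : Type u) {A A' : Set U}, A ⊆ A' → app U A ⊆ app U A'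

/-- The parameters of the coalgebraic `μ`-calculus: a modal similarity type `Λ` (of unary
modalities) closed under duals, a set functor `F`, and an interpretation of the modalities by
monotone predicate liftings for `F` that respects duality. -/
structure CoalgLogic where
  Λ : Type u
  dual : Λ → Λ
  dual_dual : ∀ h, dual (dual h) = h
  F : Type u ⥤ Type u
  sem : Λ → PredLifting F
  sem_dual : ∀ (h : Λ) (U : Type u) (A : Set U), (sem (dual h)).app U A = ((sem h).app U Aᶜ)ᶜ

/-! ### Formulae -/

/-- The (countably infinite) set of fixpoint variables. -/
abbrev Var : Type := ℕ

/-- The two fixpoint operators. -/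
inductive FixOp : Type
  | mu
  | nu

/-- Formulae of the coalgebraic `μ`-calculus; `fix η X φ` is `η X. φ`. -/
inductive Formula (Λ : Type u) : Type u
  | bot : Formula Λ
  | top : Formula Λ
  | and : Formula Λ → Formula Λ → Formula Λ
  | or : Formula Λ → Formula Λ → Formula Λ
  | modal : Λ → Formula Λ → Formula Λ
  | var : Var → Formula Λ
  | negVar : Var → Formula Λ
  | fix : FixOp → Var → Formula Λ → Formula Λ

namespace Formula

variable {Λ : Type u}

/-- Free fixpoint variables. -/
def FV : Formula Λ → Set Var
  | bot => ∅
  | top => ∅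
  | and φ ψ => FV φ ∪ FV ψ
  | or φ ψ => FV φ ∪ FV ψ
  | modal _ φ => FV φ
  | var X => {X}
  | negVar X => {X}
  | fix _ X φ => FV φ \ {X}

/-- The list of variables bound by the fixpoint operators occurring in a formula, with one entry
per occurrence of an operator. -/
def binders : Formula Λ → List Var
  | bot => []
  | top => []
  | and φ ψ => binders φ ++ binders ψ
  | or φ ψ => binders φ ++ binders ψ
  | modal _ φ => binders φ
  | var _ => []
  | negVar _ => []
  | fix _ X φ => X :: binders φ

/-- The variables that occur negated in a formula. -/
def negVars : Formula Λ → Set Var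
  | bot => ∅
  | top => ∅
  | and φ ψ => negVars φ ∪ negVars ψ
  | or φ ψ => negVars φ ∪ negVars ψ
  | modal _ φ => negVars φ
  | var _ => ∅
  | negVar X => {X}
  | fix _ _ φ => negVars φ

/-- The syntactic restriction on negation: `¬X` does not occur in the scope of `μX` or `νX`. -/
def WellFormed : Formula Λ → Prop
  | bot => True
  | top => True
  | and φ ψ => WellFormed φ ∧ WellFormed ψ
  | or φ ψ => WellFormed φ ∧ WellFormed ψ
  | modal _ φ => WellFormed φ
  | var _ => True
  | negVar _ => True
  | fix _ X φ => X ∉ negVars φ ∧ WellFormed φ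

/-- A formula is closed if it has no free fixpoint variables. -/
def Closed (φ : Formula Λ) : Prop := FV φ = ∅

/-- A formula is clean if each fixpoint variable appears in at most one fixpoint operator. -/
def Clean (φ : Formula Λ) : Prop := (binders φ).Nodup

/-- The set of subformulae. -/
def sub : Formula Λ → Set (Formula Λ)
  | bot => {bot}
  | top => {top}
  | and φ ψ => insert (and φ ψ) (sub φ ∪ sub ψ)
  | or φ ψ => insert (or φ ψ) (sub φ ∪ sub ψ)
  | modal h φ => insert (modal h φ) (sub φ)
  | var X => {var X}
  | negVar X => {negVar X}
  | fix η X φ => insert (fix η X φ) (sub φ)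

/-- The length `|φ|`: the number of symbols from
`{⊥, ⊤, ∧, ∨} ∪ Λ ∪ Var ∪ {ηX. | η ∈ {μ, ν}, X ∈ Var}`. -/
def length : Formula Λ → ℕ
  | bot => 1
  | top => 1
  | and φ ψ => length φ + length ψ + 1
  | or φ ψ => length φ + length ψ + 1
  | modal _ φ => length φ + 1
  | var _ => 1
  | negVar _ => 1
  | fix _ _ φ => length φ + 1

/-- `subst X ρ φ` is `φ[ρ/X]`. It is used only to unfold closed fixpoints `ρ = ηX. φ`, so there is
no variable capture, and `¬X` does not occur in `φ`. -/
def subst (X : Var) (ρ : Formula Λ) : Formula Λ → Formula Λ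
  | bot => bot
  | top => top
  | and φ ψ => and (subst X ρ φ) (subst X ρ ψ)
  | or φ ψ => or (subst X ρ φ) (subst X ρ ψ)
  | modal h φ => modal h (subst X ρ φ)
  | var Y => if Y = X then ρ else var Y
  | negVar Y => negVar Y
  | fix η Y φ => if Y = X then fix η Y φ else fix η Y (subst X ρ φ)

/-- `φ` is a disjunction. -/
def IsOr (φ : Formula Λ) : Prop := ∃ ψ₁ ψ₂, φ = or ψ₁ ψ₂

/-- `φ` is of the form `♡ψ`. -/
def IsModal (φ : Formula Λ) : Prop := ∃ h ψ, φ = modal h ψ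

/-! ### Alternation depth, relative to a target formula `χ` -/

/-- `θ = θ(X)`: it is the subformula of `χ` of the shape `ηX. ψ` (unique if `χ` is clean). -/
def IsTheta (χ : Formula Λ) (X : Var) (θ : Formula Λ) : Prop :=
  θ ∈ sub χ ∧ ∃ η ψ, θ = fix η X ψ

/-- `X` is an `η`-variable. -/
def IsEtaVar (χ : Formula Λ) (η : FixOp) (X : Var) : Prop := ∃ ψ, fix η X ψ ∈ sub χ

/-- `DepLt χ Y X`: `θ(Y)` is a subformula of `θ(X)`, and `X` is free in `θ(Y)`. -/
def DepLt (χ : Formula Λ) (Y X : Var) : Prop :=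
  ∃ θY θX, IsTheta χ Y θY ∧ IsTheta χ X θX ∧ θY ∈ sub θX ∧ X ∈ FV θY

/-- A dependency chain `X_n ≺ … ≺ X_0` in `χ` of bound variables. -/
def IsDepChain (χ : Formula Λ) (n : ℕ) (c : Fin (n + 1) → Var) : Prop :=
  (∀ i, c i ∈ binders χ) ∧ ∀ i : Fin n, DepLt χ (c i.succ) (c i.castSucc)

/-- The alternation number of a chain: one plus the number of `i` at which it toggles between
`μ`- and `ν`-variables. -/
noncomputable def altNumber (χ : Formula Λ) (n : ℕ) (c : Fin (n + 1) → Var) : ℕ :=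
  {i : Fin n | IsEtaVar χ .mu (c i.castSucc) ↔ IsEtaVar χ .nu (c i.succ)}.ncard + 1

/-- The alternation depth of a variable: the maximal alternation number of dependency chains ending
in `X_0 = X` (chains in a clean formula have bounded length, so the supremum is a maximum). -/
noncomputable def adVar (χ : Formula Λ) (X : Var) : ℕ :=
  sSup {m | ∃ (n : ℕ) (c : Fin (n + 1) → Var), IsDepChain χ n c ∧ c 0 = X ∧ m = altNumber χ n c}

/-- The alternation depth of `χ`; it is `0` if `χ` contains no fixpoint operator. -/
noncomputable def ad (χ : Formula Λ) : ℕ := (binders χ).toFinset.sup (adVar χ)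

/-- The Fischer-Ladner closure of `χ`. -/
inductive InClosure (χ : Formula Λ) : Formula Λ → Prop
  | self : InClosure χ χ
  | and_left {φ ψ} : InClosure χ (and φ ψ) → InClosure χ φ
  | and_right {φ ψ} : InClosure χ (and φ ψ) → InClosure χ ψ
  | or_left {φ ψ} : InClosure χ (or φ ψ) → InClosure χ φ
  | or_right {φ ψ} : InClosure χ (or φ ψ) → InClosure χ ψ
  | modal {h φ} : InClosure χ (modal h φ) → InClosure χ φ
  | unfold {η X φ} : InClosure χ (fix η X φ) → InClosure χ (subst X (fix η X φ) φ)

end Formula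

/-! ### Parity automata -/

/-- The maximum of the set of numbers occurring infinitely often in `p` exists and is even. -/
def MaxInfEven (p : ℕ → ℕ) : Prop :=
  ∃ m, IsGreatest {m | ∃ᶠ n in Filter.atTop, p n = m} m ∧ Even m

/-- A nondeterministic parity automaton over the alphabet `S` with set of nodes `V`. -/
structure ParityAutomaton (V : Type*) (S : Type*) where
  trans : V → S → V → Prop
  start : V
  priority : V → ℕ

/-- The language of infinite words accepted by a parity automaton. -/
def ParityAutomaton.language {V S : Type*} (A : ParityAutomaton V S) : Set (ℕ → S) :=
  {x | ∃ ρ : ℕ → V, ρ 0 = A.start ∧ (∀ i, A.trans (ρ i) (x i) (ρ (i + 1))) ∧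
    MaxInfEven fun i => A.priority (ρ i)}

/-! ### The tracking automaton -/

section Tracking

variable {Λ : Type u}

/-- The Fischer-Ladner closure as a type. -/
abbrev Closure (χ : Formula Λ) : Type u := {φ : Formula Λ // Formula.InClosure χ φ}

/-- Choice functions, picking a disjunct from each disjunction in the closure. -/
def Choice (χ : Formula Λ) : Type u :=
  {τ : {φ : Closure χ // φ.1.IsOr} → Closure χ //
    ∀ φ ψ₁ ψ₂, φ.1.1 = Formula.or ψ₁ ψ₂ → (τ φ).1 = ψ₁ ∨ (τ φ).1 = ψ₂}

/-- Selections: sets of modal literals in the closure. -/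
abbrev Selection (χ : Formula Λ) : Type u := Set {φ : Closure χ // φ.1.IsModal}

/-- The alphabet: the disjoint union of the set of choice functions and the set of selections. -/
inductive Letter (χ : Formula Λ) : Type u
  | choice : Choice χ → Letter χ
  | sel : Selection χ → Letter χ

/-- The transition relation `Δ` of the tracking automaton. -/
inductive Track (χ : Formula Λ) : Closure χ → Letter χ → Closure χ → Prop
  | or (τ : Choice χ) (φ : Closure χ) (h : φ.1.IsOr) : Track χ φ (.choice τ) (τ.1 ⟨φ, h⟩)
  | and_left (τ : Choice χ) (φ ψ : Closure χ) (ρ : Formula Λ) :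
      φ.1 = .and ψ.1 ρ → Track χ φ (.choice τ) ψ
  | and_right (τ : Choice χ) (φ ψ : Closure χ) (ρ : Formula Λ) :
      φ.1 = .and ρ ψ.1 → Track χ φ (.choice τ) ψ
  | unfold (τ : Choice χ) (φ ψ : Closure χ) (η : FixOp) (X : Var) (ρ : Formula Λ) :
      φ.1 = .fix η X ρ → ψ.1 = ρ.subst X φ.1 → Track χ φ (.choice τ) ψ
  | modal (τ : Choice χ) (φ : Closure χ) : φ.1.IsModal → Track χ φ (.choice τ) φ
  | sel (κ : Selection χ) (φ ψ : Closure χ) (h : Λ) (hφ : φ.1.IsModal) :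
      (⟨φ, hφ⟩ : {φ : Closure χ // φ.1.IsModal}) ∈ κ → φ.1 = .modal h ψ.1 →
      Track χ φ (.sel κ) ψ

/-- The priority function of the tracking automaton. -/
noncomputable def trackPriority (χ : Formula Λ) : Formula Λ → ℕ
  | .fix .mu X _ => 2 * χ.adVar X
  | .fix .nu X _ => 2 * χ.adVar X - 1
  | _ => 1

/-- The tracking automaton for `χ`. -/
noncomputable def trackingAutomaton (χ : Formula Λ) :
    ParityAutomaton (Closure χ) (Letter χ) where
  trans := Track χ
  start := ⟨χ, .self⟩
  priority φ := trackPriority χ φ.1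

/-- The number `2 n₀ k` of priorities of the co-determinized tracking automaton, where `n₀ = |χ|`
and `k` is the alternation depth of `χ`, read as `1` if `χ` contains no fixpoint operators (an
automaton needs at least one priority). -/
noncomputable def numPriorities (χ : Formula Λ) : ℕ := 2 * χ.length * max 1 χ.ad

/-- Co-determinized tracking automata for `χ`, as produced by any determinization procedure (such
as the Safra/Piterman construction) followed by complementation: finite deterministic parity
automata with priorities `1, …, 2 n₀ k` that accept the complement of the language of the tracking
automaton, together with a labelling of states by sets of formulae that evolves under transitions
like macrostates in the powerset construction. -/
structure CoDetTracking (χ : Formula Λ) where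
  D : Type w
  finite : Finite D
  δ : D → Letter χ → D
  start : D
  Ω : D → ℕ
  one_le_Ω : ∀ q, 1 ≤ Ω q
  Ω_le : ∀ q, Ω q ≤ numPriorities χ
  language_eq : (ParityAutomaton.mk (fun q a q' => δ q a = q') start Ω).language =
    (trackingAutomaton χ).languageᶜ
  lab : D → Set (Closure χ)
  lab_start : lab start = {⟨χ, .self⟩}
  lab_δ : ∀ q a, lab (δ q a) = {ψ | ∃ φ ∈ lab q, Track χ φ a ψ}

end Tracking

/-! ### One-step satisfiability -/

/-- The interpretation of `a ∈ V` over `Θ ⊆ 𝒫 V`. -/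
def sem0 {V : Type u} (Θ : Set (Set V)) (a : V) : Set Θ := {v | a ∈ v.1}

/-- The interpretation of a set `γ` of modal literals over `V` (the pair `(♡, a)` stands for `♡a`)
over `Θ ⊆ 𝒫 V`, a subset of `F Θ`. -/
def sem1 (L : CoalgLogic.{u}) {V : Type u} (γ : Set (L.Λ × V)) (Θ : Set (Set V)) :
    Set (L.F.obj Θ) :=
  ⋂ p ∈ γ, (L.sem p.1).app Θ (sem0 Θ p.2)

/-- One-step satisfiability is monotone in `Θ`. -/
theorem sem1_nonempty_mono (L : CoalgLogic.{u}) {V : Type u} (γ : Set (L.Λ × V))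
    {Θ Θ' : Set (Set V)} (h : Θ ⊆ Θ') (hs : (sem1 L γ Θ).Nonempty) :
    (sem1 L γ Θ').Nonempty := by
  obtain ⟨t, ht⟩ := hs
  refine ⟨L.F.map (TypeCat.ofHom (Set.inclusion h)) t, ?_⟩
  simp only [sem1, Set.mem_iInter] at ht ⊢
  intro p hp
  have h1 := ht p hp
  have h2 : sem0 Θ p.2 = Set.inclusion h ⁻¹' sem0 Θ' p.2 := rfl
  rw [h2, (L.sem p.1).natural] at h1
  exact h1

section Game

variable (L : CoalgLogic.{u}) {χ : Formula L.Λ} (B : CoDetTracking.{u, w} χ)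

/-- The set `l(q) ∩ Λ(𝐅)` of modal literals in the label of `q`. -/
def modalLits (q : B.D) : Set (L.Λ × Closure χ) :=
  {p | ∃ φ ∈ B.lab q, φ.1 = .modal p.1 p.2.1}

/-- The label of `q` contains `⊥`. -/
def HasBot (q : B.D) : Prop := ∃ φ ∈ B.lab q, φ.1 = .bot

/-- The set `δ(q, selections)`. -/
def selSucc (q : B.D) : Set B.D := Set.range fun κ : Selection χ => B.δ q (.sel κ)

/-! ### The fixpoint -/

/-- The one-step propagation function `f`. Its argument is the family of the sets `X_i`, of which
only `X_1, …, X_{2 n₀ k}` matter. -/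
def propagate (X : ℕ → Set B.D) : Set B.D :=
  {q | (sem1 L (modalLits L B q) (B.lab '' (selSucc L B q ∩ X (B.Ω q)))).Nonempty ∧
    ¬ HasBot L B q ∧ ∃ τ : Choice χ, B.δ q (.choice τ) ∈ X (B.Ω q)}

theorem propagate_mono : Monotone (propagate L B) := by
  rintro X Y h q ⟨h1, h2, τ, h3⟩
  refine ⟨sem1_nonempty_mono L _ ?_ h1, h2, τ, h _ h3⟩
  exact Set.image_mono (Set.inter_subset_inter_right _ (h _))

end Game

/-- `nestedFix f i X` is `η_i X_i. … η_1 X_1. f(X_1, X_2, …)` as a function of the remaining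
variables, where `η_j = μ` for odd `j` and `η_j = ν` for even `j`. -/
def nestedFix {α : Type*} [CompleteLattice α] (f : (ℕ → α) →o α) : ℕ → ((ℕ → α) →o α)
  | 0 => f
  | i + 1 =>
    { toFun := fun X =>
        let g : α →o α :=
          ⟨fun A => nestedFix f i (Function.update X (i + 1) A),
            fun _ _ h => (nestedFix f i).monotone (Function.update_mono h)⟩
        if Odd (i + 1) then OrderHom.lfp g else OrderHom.gfp g
      monotone' := by
        intro X Y h
        have key : ∀ A, nestedFix f i (Function.update X (i + 1) A) ≤
            nestedFix f i (Function.update Y (i + 1) A) := fun A =>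
          (nestedFix f i).monotone (update_le_update_iff.2 ⟨le_rfl, fun j _ => h j⟩)
        dsimp only
        split_ifs
        · exact OrderHom.lfp.monotone key
        · exact OrderHom.gfp.monotone key }

/-- The set `𝐄 = η_{2n₀k} X_{2n₀k}. … η_1 X_1. f(X_1, …, X_{2n₀k})`. All relevant variables are
bound, so the values initially assigned to them are irrelevant. -/
noncomputable def fixE (L : CoalgLogic.{u}) {χ : Formula L.Λ} (B : CoDetTracking.{u, w} χ) :
    Set B.D :=
  nestedFix ⟨propagate L B, propagate_mono L B⟩ (numPriorities χ) fun _ => ∅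

/-! ### Parity games -/

/-- A parity game on the set `V` of nodes (without designated initial node); the nodes outside
`exNodes` belong to the universal player. -/
structure ParityGame (V : Type*) where
  exNodes : Set V
  move : V → V → Prop
  priority : V → ℕ

namespace ParityGame

variable {V : Type*} (G : ParityGame V)

/-- A play is a maximal path `node 0, node 1, …`; it is infinite if `last = ⊤`, and otherwise it
ends in `node last`, a node without outgoing moves (later values of `node` are meaningless). -/
structure Play where
  last : ℕ∞
  node : ℕ → V
  move_node : ∀ i : ℕ, (i : ℕ∞) < last → G.move (node i) (node (i + 1))
  maximal : ∀ n : ℕ, last = n → ∀ v, ¬ G.move (node n) v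

/-- A (history-dependent) strategy for the existential player maps a partial play `v_0, …, v_n`
ending in one of her nodes to a legal move from `v_n`, provided there is one; other values are
meaningless. -/
def IsStrategy (s : List V → V) : Prop :=
  ∀ (h : List V) (v : V), v ∈ G.exNodes → (∃ v', G.move v v') → G.move v (s (h ++ [v]))

variable {G}

/-- The play follows the strategy `s` of the existential player. -/
def Play.Follows (π : G.Play) (s : List V → V) : Prop :=
  ∀ n : ℕ, (n : ℕ∞) < π.last → π.node n ∈ G.exNodes →
    π.node (n + 1) = s ((List.range (n + 1)).map π.node)

/-- The play is winning for the existential player: it is finite and the universal player is stuck,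
or it is infinite and the highest priority visited infinitely often is even. -/
def Play.ExWins (π : G.Play) : Prop :=
  (∃ n : ℕ, π.last = n ∧ π.node n ∉ G.exNodes) ∨
    (π.last = ⊤ ∧ MaxInfEven fun i => G.priority (π.node i))

variable (G)

/-- The existential player wins the node `v`. -/
def ExWinsNode (v : V) : Prop :=
  ∃ s, G.IsStrategy s ∧ ∀ π : G.Play, π.node 0 = v → π.Follows s → π.ExWins

end ParityGame

/-! ### The satisfiability game -/

section SatGame

variable (L : CoalgLogic.{u}) {χ : Formula L.Λ} (B : CoDetTracking.{u, w} χ)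

/-- The nodes `q`, `(q, 0)`, `(q, 1)` and `(q, Ξ)` of the satisfiability game. -/
inductive SatNode : Type (max u w)
  | state : B.D → SatNode
  | zero : B.D → SatNode
  | one : B.D → SatNode
  | sels : B.D → Set (Selection χ) → SatNode

/-- The moves of the satisfiability game. -/
inductive SatMove : SatNode L B → SatNode L B → Prop
  | to_zero (q : B.D) : SatMove (.state q) (.zero q)
  | to_one (q : B.D) : SatMove (.state q) (.one q)
  | choose (q : B.D) (τ : Choice χ) : ¬ HasBot L B q →
      SatMove (.zero q) (.state (B.δ q (.choice τ)))
  | select (q : B.D) (Ξ : Set (Selection χ)) :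
      (sem1 L (modalLits L B q) (B.lab '' ((fun κ => B.δ q (.sel κ)) '' Ξ))).Nonempty →
      SatMove (.one q) (.sels q Ξ)
  | step (q : B.D) (Ξ : Set (Selection χ)) (κ : Selection χ) : κ ∈ Ξ →
      SatMove (.sels q Ξ) (.state (B.δ q (.sel κ)))

/-- The satisfiability game. -/
def satGame : ParityGame (SatNode L B) where
  exNodes := {v | ∃ q, v = .zero q ∨ v = .one q}
  move := SatMove L B
  priority
    | .state q => B.Ω q
    | _ => 0

end SatGame

end CoalgMu

/-!
Membership in a nested fixpoint, and likewise non-membership, is witnessed by a *trace*: a relation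
`T` on states along which membership can be propagated by one-step moves, and all of whose infinite
paths satisfy the parity condition. A trace is obtained by unfolding the fixpoints from the inside
out; at a least fixpoint it has to decrease an ordinal rank whenever the variable of this fixpoint
is unfolded, which can happen only finitely often. Traces of the propagation function lift to traces
of the satisfiability game, where they are positional winning strategies of the existential and of
the universal player, respectively.
-/

namespace CoalgMu

open Filter Set

/-! ### The parity condition -/

section MaxInf

variable {Q : ℕ → Prop} {p : ℕ → ℕ}

/-- The parity condition with an arbitrary set `Q` of good priorities: the maximum of the set of
numbers occurring infinitely often in `p` exists and is in `Q`. It is `MaxInfEven` for `Q = Even`;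
the universal player aims for `Q = Odd`. -/
def MaxInf (Q : ℕ → Prop) (p : ℕ → ℕ) : Prop :=
  ∃ m, IsGreatest {m | ∃ᶠ n in atTop, p n = m} m ∧ Q m

theorem MaxInf.not_maxInfEven (h : MaxInf Odd p) : ¬ MaxInfEven p := by
  obtain ⟨m, hm, hodd⟩ := h
  rintro ⟨m', hm', heven⟩
  exact Nat.not_even_iff_odd.2 hodd (hm'.unique hm ▸ heven)

theorem MaxInf.of_comp {a : ℕ → ℕ} (ha : StrictMono a)
    (h0 : ∀ᶠ n in atTop, p n = 0 ∨ n ∈ range a) (h : MaxInf Q fun k => p (a k)) :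
    MaxInf Q p := by
  obtain ⟨m, ⟨hm, hmax⟩, hQ⟩ := h
  refine ⟨m, ⟨ha.tendsto_atTop.frequently hm, fun m' hm' => ?_⟩, hQ⟩
  rcases eq_or_ne m' 0 with rfl | hne
  · exact Nat.zero_le m
  · refine hmax (frequently_atTop.2 fun k => ?_)
    obtain ⟨n, ⟨hn, hn0⟩, hkn⟩ :=
      ((hm'.and_eventually h0).and_eventually (eventually_ge_atTop (a k))).exists
    obtain ⟨j, rfl⟩ := hn0.resolve_left (hn ▸ hne)
    exact ⟨j, ha.le_iff_le.1 hkn, hn⟩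

theorem MaxInf.of_shift (N : ℕ) (h : MaxInf Q fun n => p (n + N)) : MaxInf Q p := by
  refine .of_comp (strictMono_id.add_const N) ?_ h
  filter_upwards [eventually_ge_atTop N] with n hn
  exact .inr ⟨n - N, Nat.sub_add_cancel hn⟩

/-- The sequence `o` follows a path of `T` with waiting times, namely at the zeros of `w`. -/
theorem MaxInf.of_delayed_path {D : Type*} {T : D → D → Prop} {Ω : D → ℕ}
    (hT : ∀ p : ℕ → D, (∀ n, T (p n) (p (n + 1))) → MaxInf Q fun n => Ω (p n))
    {o : ℕ → D} {w : ℕ → ℕ} (hw : ∀ n, w n ≠ 0 → w n = Ω (o n))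
    (hinf : ∃ᶠ n in atTop, w n ≠ 0) (hwait : ∀ n, w (n + 1) = 0 → o (n + 1) = o n)
    (hmove : ∀ n, w (n + 1) ≠ 0 → T (o n) (o (n + 1))) : MaxInf Q w := by
  have hinf : {n | w n ≠ 0}.Infinite := Nat.frequently_atTop_iff_infinite.1 hinf
  let a : ℕ → ℕ := Nat.nth fun n => w n ≠ 0
  have ha : StrictMono a := Nat.nth_strictMono hinf
  have hrange : ∀ n, w n ≠ 0 → n ∈ range a := fun n hn => (Nat.range_nth_of_infinite hinf).ge hn
  have hne : ∀ k, w (a k) ≠ 0 := Nat.nth_mem_of_infinite hinf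
  have hconst : ∀ k n, a k ≤ n → n < a (k + 1) → o n = o (a k) := by
    intro k n hn
    induction n, hn using Nat.le_induction with
    | base => exact fun _ => rfl
    | succ n hkn ih =>
      intro hlt
      rw [hwait, ih (by omega)]
      by_contra h
      obtain ⟨j, hj⟩ := hrange _ h
      have hkj : k < j := ha.lt_iff_lt.1 (by omega)
      have hjk : j < k + 1 := ha.lt_iff_lt.1 (by omega)
      omega
  refine .of_comp ha (.of_forall fun n => or_iff_not_imp_left.2 (hrange n)) ?_
  simp only [hw _ (hne _)]
  refine hT _ fun k => ?_
  have hk : a k < a (k + 1) := ha k.lt_succ_self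
  obtain ⟨n, hn⟩ : ∃ n, a (k + 1) = n + 1 := Nat.exists_eq_add_one.2 (by omega)
  rw [← hconst k n (by omega) (by omega), hn]
  exact hmove n (hn ▸ hne (k + 1))

end MaxInf

/-! ### Ranks for least fixpoints -/

/-- The dual `A ↦ (Φ Aᶜ)ᶜ` of an operator on sets. -/
def dualOp {D : Type*} (Φ : Set D →o Set D) : Set D →o Set D :=
  ⟨fun A => (Φ Aᶜ)ᶜ, fun _ _ h => compl_subset_compl.2 (Φ.monotone (compl_subset_compl.2 h))⟩

theorem compl_gfp {D : Type*} (g : Set D →o Set D) :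
    (OrderHom.gfp g)ᶜ = OrderHom.lfp (dualOp g) := by
  apply le_antisymm
  · refine compl_le_iff_compl_le.1 (OrderHom.le_gfp g ?_)
    exact compl_le_iff_compl_le.1 (OrderHom.map_lfp (dualOp g)).le
  · refine OrderHom.lfp_le (dualOp g) ?_
    change (g (OrderHom.gfp g)ᶜᶜ)ᶜ ≤ _
    rw [compl_compl, OrderHom.map_gfp]

/-- The rank of `q` is the stage at which `q` enters the least fixpoint. -/
theorem exists_rank_lfp {D : Type w} (g : Set D →o Set D) :
    ∃ r : D → Ordinal.{w}, ∀ a,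
      g {q ∈ OrderHom.lfp g | r q < a} = {q ∈ OrderHom.lfp g | r q ≤ a} := by
  let stage := OrdinalApprox.lfpApprox g ⊥
  have stage_mono : Monotone stage := OrdinalApprox.lfpApprox_mono_right g
  have mem_stage : ∀ {q a}, q ∈ stage a ↔ ∃ b < a, q ∈ g (stage b) := by
    intro q a
    simp only [stage]
    rw [OrdinalApprox.lfpApprox]
    simp
  let r : D → Ordinal.{w} := fun q => sInf {a | q ∈ g (stage a)}
  have rank_le : ∀ {q a}, q ∈ g (stage a) → r q ≤ a := fun hq => csInf_le' hq
  obtain ⟨c, hc⟩ := OrdinalApprox.lfp_mem_range_lfpApprox g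
  have mem_rank : ∀ {q}, q ∈ OrderHom.lfp g → q ∈ g (stage (r q)) := by
    intro q hq
    rw [← OrderHom.map_lfp, ← hc] at hq
    exact csInf_mem (s := {a | q ∈ g (stage a)}) ⟨c, hq⟩
  have stage_le : ∀ a, stage a ≤ OrderHom.lfp g := fun a =>
    OrdinalApprox.lfpApprox_le_of_mem_fixedPoints g (OrderHom.map_lfp g) bot_le a
  have apply_stage : ∀ a, g (stage a) = {q ∈ OrderHom.lfp g | r q ≤ a} := by
    refine fun a => Subset.antisymm (fun q hq => ⟨?_, rank_le hq⟩) fun q hq => ?_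
    · exact (OrderHom.map_lfp g).le (g.monotone (stage_le a) hq)
    · exact g.monotone (stage_mono hq.2) (mem_rank hq.1)
  refine ⟨r, fun a => ?_⟩
  rw [← apply_stage]
  congr 1
  ext q
  refine ⟨fun hq => mem_stage.2 ⟨r q, hq.2, mem_rank hq.1⟩, fun hq => ?_⟩
  obtain ⟨b, hb, hqb⟩ := mem_stage.1 hq
  exact ⟨stage_le a hq, (rank_le hqb).trans_lt hb⟩

/-! ### Traces -/

section Trace

variable {D : Type*} (Φ : Set D →o Set D) (Ω : D → ℕ) (Q : ℕ → Prop)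

/-- A trace on `W` for the one-step operator `Φ`: from each state in `W` one step of `Φ` leads back
to `W` along `T`, and the paths of `T` satisfy the parity condition. If `Φ` is the controllable
predecessor operator of a player in a parity game, then `T` is a positional strategy that is winning
on `W`. -/
structure IsTrace (W : Set D) (T : D → D → Prop) : Prop where
  step : ∀ q ∈ W, q ∈ Φ {q' ∈ W | T q q'}
  maxInf : ∀ p : ℕ → D, (∀ n, T (p n) (p (n + 1))) → MaxInf Q fun n => Ω (p n)

/-- A trace in which only the priorities up to `i` are unfolded: steps from states of a higher
priority `j` lead to the set `X j` and end the trace. -/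
structure IsPartialTrace (i : ℕ) (X : ℕ → Set D) (W : Set D) (T : D → D → Prop) : Prop where
  step : ∀ q ∈ W, q ∈ Φ (if Ω q ≤ i then {q' ∈ W | T q q'} else X (Ω q))
  maxInf : ∀ p : ℕ → D, (∀ n, Ω (p n) ≤ i ∧ T (p n) (p (n + 1))) → MaxInf Q fun n => Ω (p n)

variable {Φ Ω Q} {i : ℕ} {X : ℕ → Set D}

theorem IsPartialTrace.isTrace {W : Set D} {T : D → D → Prop}
    (h : IsPartialTrace Φ Ω Q i X W T) (hi : ∀ q, Ω q ≤ i) : IsTrace Φ Ω Q W T where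
  step q hq := by simpa only [hi q, if_true] using h.step q hq
  maxInf p hp := h.maxInf p fun n => ⟨hi _, hp n⟩

theorem isPartialTrace_zero (hΩ : ∀ q, 1 ≤ Ω q) {W : Set D}
    (hW : ∀ q ∈ W, q ∈ Φ (X (Ω q))) : IsPartialTrace Φ Ω Q 0 X W fun _ _ => False where
  step q hq := by
    rw [if_neg (Nat.not_le_of_lt (hΩ q))]
    exact hW q hq
  maxInf _ hp := (hp 0).2.elim

theorem IsPartialTrace.succ_of_good {W : Set D} {T : D → D → Prop} (hQ : Q (i + 1))
    (h : IsPartialTrace Φ Ω Q i (Function.update X (i + 1) W) W T) :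
    IsPartialTrace Φ Ω Q (i + 1) X W fun q q' => Ω q ≤ i → T q q' where
  step q hq := by
    refine Φ.monotone ?_ (h.step q hq)
    rcases lt_trichotomy (Ω q) (i + 1) with hlt | heq | hgt
    · rw [if_pos (Nat.le_of_lt_succ hlt), if_pos hlt.le]
      exact fun q' hq' => ⟨hq'.1, fun _ => hq'.2⟩
    · rw [if_neg (by omega), if_pos heq.le, heq, Function.update_self]
      exact fun q' hq' => ⟨hq', by omega⟩
    · rw [if_neg (by omega), if_neg (by omega), Function.update_of_ne hgt.ne']
  maxInf p hp := by
    by_cases hfreq : ∃ᶠ n in atTop, Ω (p n) = i + 1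
    · refine ⟨i + 1, ⟨hfreq, fun m hm => ?_⟩, hQ⟩
      obtain ⟨n, rfl⟩ := Frequently.exists hm
      exact (hp n).1
    · obtain ⟨N, hN⟩ := eventually_atTop.1 (not_frequently.1 hfreq)
      have hle : ∀ n, Ω (p (n + N)) ≤ i := fun n =>
        Nat.le_of_lt_succ ((hp _).1.lt_of_ne (hN _ (Nat.le_add_left N n)))
      refine .of_shift N (h.maxInf (fun n => p (n + N)) fun n => ⟨hle n, ?_⟩)
      rw [Nat.add_right_comm]
      exact (hp (n + N)).2 (hle n)

/-- Here `r` is the rank of a least fixpoint. It never increases along the new trace and decreases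
at priority `i + 1`, so that it is eventually constant, say `a`, and the path eventually follows
`T a` without visiting the priority `i + 1`. -/
theorem IsPartialTrace.succ_of_rank {W : Set D} {r : D → Ordinal} {T : Ordinal → D → D → Prop}
    (h : ∀ a, IsPartialTrace Φ Ω Q i (Function.update X (i + 1) {q ∈ W | r q < a})
      {q ∈ W | r q ≤ a} (T a)) :
    IsPartialTrace Φ Ω Q (i + 1) X W fun q q' =>
      r q' ≤ r q ∧ (Ω q = i + 1 → r q' < r q) ∧ (Ω q ≤ i → T (r q) q q') where
  step q hq := by
    refine Φ.monotone ?_ ((h (r q)).step q ⟨hq, le_rfl⟩)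
    rcases lt_trichotomy (Ω q) (i + 1) with hlt | heq | hgt
    · rw [if_pos (Nat.le_of_lt_succ hlt), if_pos hlt.le]
      exact fun q' hq' => ⟨hq'.1.1, hq'.1.2, by omega, fun _ => hq'.2⟩
    · rw [if_neg (by omega), if_pos heq.le, heq, Function.update_self]
      exact fun q' hq' => ⟨hq'.1, hq'.2.le, fun _ => hq'.2, by omega⟩
    · rw [if_neg (by omega), if_neg (by omega), Function.update_of_ne hgt.ne']
  maxInf p hp := by
    have hanti : Antitone fun n => r (p n) := antitone_nat_of_succ_le fun n => (hp n).2.1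
    obtain ⟨N, hN⟩ := WellFoundedLT.antitone_chain_condition hanti
    have hconst : ∀ n, r (p (n + N)) = r (p N) := fun n => (hN _ (Nat.le_add_left N n)).symm
    have hle : ∀ n, Ω (p (n + N)) ≤ i := fun n => by
      refine Nat.le_of_lt_succ ((hp _).1.lt_of_ne fun heq => ((hp _).2.2.1 heq).ne ?_)
      rw [hconst, Nat.add_right_comm, hconst]
    refine .of_shift N ((h (r (p N))).maxInf (fun n => p (n + N)) fun n => ⟨hle n, ?_⟩)
    rw [← hconst n, Nat.add_right_comm]
    exact (hp (n + N)).2.2.2 (hle n)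

end Trace

/-! ### Traces of nested fixpoints -/

section NestedFix

/-- The operator whose least or greatest fixpoint is `nestedFix f (i + 1) X`. -/
def nestedStep {α : Type*} [CompleteLattice α] (f : (ℕ → α) →o α) (i : ℕ) (X : ℕ → α) : α →o α :=
  ⟨fun A => nestedFix f i (Function.update X (i + 1) A),
    fun _ _ h => (nestedFix f i).monotone (Function.update_mono h)⟩

theorem nestedFix_succ_of_odd {α : Type*} [CompleteLattice α] (f : (ℕ → α) →o α) {i : ℕ}
    (h : Odd (i + 1)) (X : ℕ → α) : nestedFix f (i + 1) X = OrderHom.lfp (nestedStep f i X) :=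
  if_pos h

theorem nestedFix_succ_of_even {α : Type*} [CompleteLattice α] (f : (ℕ → α) →o α) {i : ℕ}
    (h : Even (i + 1)) (X : ℕ → α) : nestedFix f (i + 1) X = OrderHom.gfp (nestedStep f i X) :=
  if_neg (Nat.not_odd_iff_even.2 h)

variable {D : Type w} (Φ : Set D →o Set D) (Ω : D → ℕ)

/-- The function `(X₁, X₂, …) ↦ {q | q ∈ Φ X_{Ω q}}`, whose nested fixpoint is the solution of the
parity condition given by `Ω` for the one-step operator `Φ`. -/
def parityStep : (ℕ → Set D) →o Set D :=
  ⟨fun X => {q | q ∈ Φ (X (Ω q))}, fun _ _ h q hq => Φ.monotone (h (Ω q)) hq⟩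

variable {Ω} (hΩ : ∀ q, 1 ≤ Ω q)
include hΩ

theorem exists_isPartialTrace_nestedFix (i : ℕ) (X : ℕ → Set D) :
    ∃ T, IsPartialTrace Φ Ω Even i X (nestedFix (parityStep Φ Ω) i X) T := by
  induction i generalizing X with
  | zero => exact ⟨_, isPartialTrace_zero hΩ fun _ hq => hq⟩
  | succ i ih =>
    rcases Nat.even_or_odd (i + 1) with heven | hodd
    · rw [nestedFix_succ_of_even _ heven]
      set W := OrderHom.gfp (nestedStep (parityStep Φ Ω) i X)
      have hW : nestedFix (parityStep Φ Ω) i (Function.update X (i + 1) W) = W :=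
        OrderHom.map_gfp (nestedStep (parityStep Φ Ω) i X)
      obtain ⟨T, hT⟩ := ih (Function.update X (i + 1) W)
      rw [hW] at hT
      exact ⟨_, hT.succ_of_good heven⟩
    · rw [nestedFix_succ_of_odd _ hodd]
      obtain ⟨r, hr⟩ := exists_rank_lfp (nestedStep (parityStep Φ Ω) i X)
      choose T hT using fun a => hr a ▸ ih (Function.update X (i + 1) _)
      exact ⟨_, .succ_of_rank hT⟩

theorem exists_isPartialTrace_compl_nestedFix (i : ℕ) (X : ℕ → Set D) :
    ∃ T, IsPartialTrace (dualOp Φ) Ω Odd i Xᶜ (nestedFix (parityStep Φ Ω) i X)ᶜ T := by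
  induction i generalizing X with
  | zero =>
    refine ⟨_, isPartialTrace_zero hΩ fun q hq => ?_⟩
    change q ∉ Φ (X (Ω q))ᶜᶜ
    rwa [compl_compl]
  | succ i ih =>
    have ih_dual : ∀ A, ∃ T, IsPartialTrace (dualOp Φ) Ω Odd i (Function.update Xᶜ (i + 1) A)
        (dualOp (nestedStep (parityStep Φ Ω) i X) A) T := fun A => by
      have hupdate : (Function.update X (i + 1) Aᶜ)ᶜ = Function.update Xᶜ (i + 1) Aᶜᶜ :=
        Function.comp_update compl X (i + 1) Aᶜ
      rw [← compl_compl A, ← hupdate, compl_compl]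
      exact ih (Function.update X (i + 1) Aᶜ)
    rcases Nat.even_or_odd (i + 1) with heven | hodd
    · rw [nestedFix_succ_of_even _ heven, compl_gfp]
      obtain ⟨r, hr⟩ := exists_rank_lfp (dualOp (nestedStep (parityStep Φ Ω) i X))
      choose T hT using fun a => hr a ▸ ih_dual _
      exact ⟨_, .succ_of_rank hT⟩
    · rw [nestedFix_succ_of_odd _ hodd]
      set W := OrderHom.lfp (nestedStep (parityStep Φ Ω) i X)
      have hW : dualOp (nestedStep (parityStep Φ Ω) i X) Wᶜ = Wᶜ := by
        change (nestedStep (parityStep Φ Ω) i X Wᶜᶜ)ᶜ = Wᶜ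
        rw [compl_compl, OrderHom.map_lfp]
      obtain ⟨T, hT⟩ := ih_dual Wᶜ
      rw [hW] at hT
      exact ⟨_, hT.succ_of_good hodd⟩

end NestedFix

/-! ### Positional strategies from traces -/

theorem exists_seq_of_history {V : Type*} (next : List V → V) (v : V) :
    ∃ x : ℕ → V, x 0 = v ∧ ∀ n, x (n + 1) = next ((List.range (n + 1)).map x) := by
  let history : ℕ → List V := Nat.rec [v] fun _ h => h ++ [next h]
  let x : ℕ → V := fun n => (history n).getLast?.getD v
  have x_succ : ∀ n, x (n + 1) = next (history n) := fun n => by simp [x, history]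
  have map_range : ∀ n, (List.range (n + 1)).map x = history n := by
    intro n
    induction n with
    | zero => rfl
    | succ n ih => rw [List.range_succ, List.map_append, ih, List.map_singleton, x_succ]
  exact ⟨x, rfl, fun n => by rw [map_range, x_succ]⟩

theorem exists_selector {V : Type*} (M R : V → V → Prop) : ∃ σ : V → V, ∀ v,
    ((∃ v', M v v') → M v (σ v)) ∧ ((∃ v', M v v' ∧ R v v') → R v (σ v)) := by
  have hσ : ∀ v, ∃ u,
      ((∃ v', M v v') → M v u) ∧ ((∃ v', M v v' ∧ R v v') → R v u) := by
    intro v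
    by_cases hR : ∃ v', M v v' ∧ R v v'
    · obtain ⟨u, hM, hu⟩ := hR
      exact ⟨u, fun _ => hM, fun _ => hu⟩
    · by_cases hM : ∃ v', M v v'
      · exact hM.imp fun u hu => ⟨fun _ => hu, fun h => (hR h).elim⟩
      · exact ⟨v, fun h => (hM h).elim, fun h => (hR h).elim⟩
  choose σ hσ using hσ
  exact ⟨σ, hσ⟩

namespace ParityGame

section Play

variable {V : Type*} {G : ParityGame V}

theorem Play.mem_of_step (π : G.Play) {W : Set V} (h0 : π.node 0 ∈ W)
    (hstep : ∀ n : ℕ, (n : ℕ∞) < π.last → π.node n ∈ W → π.node (n + 1) ∈ W) (n : ℕ)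
    (hn : (n : ℕ∞) ≤ π.last) : π.node n ∈ W := by
  induction n with
  | zero => exact h0
  | succ n ih =>
    have hlt : (n : ℕ∞) < π.last := (Nat.cast_lt.2 n.lt_succ_self).trans_le hn
    exact hstep n hlt (ih hlt.le)

theorem exists_play_of_seq {x : ℕ → V}
    (hx : ∀ n, (∃ v, G.move (x n) v) → G.move (x n) (x (n + 1))) :
    ∃ π : G.Play, π.node = x := by
  classical
  by_cases hstuck : ∃ n, ∀ v, ¬ G.move (x n) v
  · refine ⟨⟨Nat.find hstuck, x, fun i hi => hx i ?_, fun n hn => ?_⟩, rfl⟩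
    · simpa only [not_forall, not_not] using Nat.find_min hstuck (Nat.cast_lt.1 hi)
    · rw [← Nat.cast_injective hn]
      exact Nat.find_spec hstuck
  · simp only [not_exists, not_forall, not_not] at hstuck
    exact ⟨⟨⊤, x, fun i _ => hx i (hstuck i), fun n h => (ENat.natCast_ne_top n h.symm).elim⟩, rfl⟩

theorem exists_play_follows {s : List V → V} (hs : G.IsStrategy s) {t : V → V}
    (ht : ∀ v ∉ G.exNodes, (∃ v', G.move v v') → G.move v (t v)) (v : V) :
    ∃ π : G.Play, π.node 0 = v ∧ π.Follows s ∧
      ∀ n, π.node n ∉ G.exNodes → π.node (n + 1) = t (π.node n) := by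
  classical
  obtain ⟨x, hx0, hx⟩ := exists_seq_of_history
    (fun h => if h.getLast?.getD v ∈ G.exNodes then s h else t (h.getLast?.getD v)) v
  have getLast_history : ∀ n, ((List.range (n + 1)).map x).getLast?.getD v = x n := fun n => by
    simp [List.range_succ]
  simp only [getLast_history] at hx
  obtain ⟨π, rfl⟩ : ∃ π : G.Play, π.node = x := by
    refine exists_play_of_seq fun n hmove => ?_
    rw [hx]
    split_ifs with hex
    · rw [List.range_succ, List.map_append]
      exact hs _ _ hex hmove
    · exact ht _ hex hmove
  exact ⟨π, hx0, fun n _ hex => by rw [hx, if_pos hex], fun n hex => by rw [hx, if_neg hex]⟩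

end Play

section Positional

variable {V : Type*} (G : ParityGame V)

/-- The controllable predecessor operator: the existential player can enforce that the next node
exists and is in `A`, or that the universal player is stuck. -/
def cpre : Set V →o Set V where
  toFun A := {v | (v ∈ G.exNodes → ∃ v', G.move v v' ∧ v' ∈ A) ∧
    (v ∉ G.exNodes → ∀ v', G.move v v' → v' ∈ A)}
  monotone' _ _ h _ hv :=
    ⟨fun hex => (hv.1 hex).imp fun _ => And.imp_right (@h _), fun hex v' hm => h (hv.2 hex v' hm)⟩

theorem mem_dualOp_cpre {v : V} {A : Set V} :
    v ∈ dualOp G.cpre A ↔ (v ∈ G.exNodes → ∀ v', G.move v v' → v' ∈ A) ∧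
      (v ∉ G.exNodes → ∃ v', G.move v v' ∧ v' ∈ A) := by
  change ¬ (_ ∧ _) ↔ _
  by_cases hv : v ∈ G.exNodes <;> simp [hv]

variable {G} {W : Set V} {T : V → V → Prop} {v : V}

theorem exWinsNode_of_isTrace (h : IsTrace G.cpre G.priority Even W T) (hv : v ∈ W) :
    G.ExWinsNode v := by
  obtain ⟨σ, hσ⟩ := exists_selector G.move fun v v' => v' ∈ W ∧ T v v'
  refine ⟨fun h => σ (h.getLast?.getD v), fun _ u _ hmove => ?_, fun π h0 hπ => ?_⟩
  · simpa using (hσ u).1 hmove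
  have hstep : ∀ n : ℕ, (n : ℕ∞) < π.last → π.node n ∈ W →
      π.node (n + 1) ∈ W ∧ T (π.node n) (π.node (n + 1)) := by
    intro n hn hW
    by_cases hex : π.node n ∈ G.exNodes
    · have hnext : π.node (n + 1) = σ (π.node n) := by simpa [List.range_succ] using hπ n hn hex
      exact hnext ▸ (hσ _).2 ((h.step _ hW).1 hex)
    · exact (h.step _ hW).2 hex _ (π.move_node n hn)
  have hW := π.mem_of_step (h0 ▸ hv) fun n hn hW => (hstep n hn hW).1
  rcases eq_or_ne π.last ⊤ with htop | hfin
  · have hlt : ∀ n : ℕ, (n : ℕ∞) < π.last := fun n => htop ▸ ENat.natCast_lt_top n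
    exact .inr ⟨htop, h.maxInf π.node fun n => (hstep n (hlt n) (hW n (hlt n).le)).2⟩
  · obtain ⟨n, hn⟩ := ENat.ne_top_iff_exists.1 hfin
    refine .inl ⟨n, hn.symm, fun hex => ?_⟩
    obtain ⟨u, hu, -⟩ := (h.step _ (hW n hn.le)).1 hex
    exact π.maximal n hn.symm u hu

theorem not_exWinsNode_of_isTrace (h : IsTrace (dualOp G.cpre) G.priority Odd W T) (hv : v ∈ W) :
    ¬ G.ExWinsNode v := by
  rintro ⟨s, hs, hwin⟩
  obtain ⟨σ, hσ⟩ := exists_selector G.move fun v v' => v' ∈ W ∧ T v v'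
  obtain ⟨π, h0, hπ, hnext⟩ := exists_play_follows hs (fun u _ => (hσ u).1) v
  have hstep : ∀ n : ℕ, (n : ℕ∞) < π.last → π.node n ∈ W →
      π.node (n + 1) ∈ W ∧ T (π.node n) (π.node (n + 1)) := by
    intro n hn hW
    have hdual := G.mem_dualOp_cpre.1 (h.step _ hW)
    by_cases hex : π.node n ∈ G.exNodes
    · exact hdual.1 hex _ (π.move_node n hn)
    · exact hnext n hex ▸ (hσ _).2 (hdual.2 hex)
  have hW := π.mem_of_step (h0 ▸ hv) fun n hn hW => (hstep n hn hW).1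
  rcases hwin π h0 hπ with ⟨n, hn, hex⟩ | ⟨htop, heven⟩
  · obtain ⟨u, hu, -⟩ := (G.mem_dualOp_cpre.1 (h.step _ (hW n hn.ge))).2 hex
    exact π.maximal n hn u hu
  · have hlt : ∀ n : ℕ, (n : ℕ∞) < π.last := fun n => htop ▸ ENat.natCast_lt_top n
    have hpath := fun n => (hstep n (hlt n) (hW n (hlt n).le)).2
    exact (h.maxInf π.node hpath).not_maxInfEven heven

end Positional

end ParityGame

/-! ### Lifting traces to the satisfiability game -/

section SatGame

variable (L : CoalgLogic.{u}) {χ : Formula L.Λ} (B : CoDetTracking.{u, w} χ)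

/-- The propagation function `f`, with the same set in place of all its arguments. -/
def propagateOp : Set B.D →o Set B.D :=
  ⟨fun A => propagate L B fun _ => A, fun _ _ h => propagate_mono L B fun _ => h⟩

variable {L B}

/-- The automaton state `q` of the nodes `q`, `(q, 0)`, `(q, 1)` and `(q, Ξ)`. -/
def SatNode.origin : SatNode L B → B.D
  | .state q | .zero q | .one q | .sels q _ => q

theorem sem1_selSucc_inter_nonempty_iff {q : B.D} {A : Set B.D} :
    (sem1 L (modalLits L B q) (B.lab '' (selSucc L B q ∩ A))).Nonempty ↔
      ∃ Ξ : Set (Selection χ), (sem1 L (modalLits L B q)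
        (B.lab '' ((fun κ => B.δ q (.sel κ)) '' Ξ))).Nonempty ∧ ∀ κ ∈ Ξ, B.δ q (.sel κ) ∈ A := by
  constructor
  · intro h
    refine ⟨{κ | B.δ q (.sel κ) ∈ A}, sem1_nonempty_mono L _ (image_mono ?_) h, fun _ hκ => hκ⟩
    rintro _ ⟨⟨κ, rfl⟩, hκ⟩
    exact mem_image_of_mem _ hκ
  · rintro ⟨Ξ, h, hΞ⟩
    refine sem1_nonempty_mono L _ (image_mono ?_) h
    rintro _ ⟨κ, hκ, rfl⟩
    exact ⟨mem_range_self κ, hΞ κ hκ⟩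

section Cpre

variable {P : Set (SatNode L B)} {q : B.D}

theorem state_mem_cpre : .state q ∈ (satGame L B).cpre P ↔ .zero q ∈ P ∧ .one q ∈ P := by
  have hex : .state q ∉ (satGame L B).exNodes := by simp [satGame]
  refine ⟨fun h => ⟨h.2 hex _ (.to_zero q), h.2 hex _ (.to_one q)⟩,
    fun h => ⟨fun h' => (hex h').elim, ?_⟩⟩
  rintro - _ (_ | _)
  exacts [h.1, h.2]

theorem zero_mem_cpre : .zero q ∈ (satGame L B).cpre P ↔
    ¬ HasBot L B q ∧ ∃ τ : Choice χ, .state (B.δ q (.choice τ)) ∈ P := by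
  have hex : .zero q ∈ (satGame L B).exNodes := ⟨q, .inl rfl⟩
  constructor
  · intro h
    obtain ⟨_, _ | _ | ⟨_, τ, hbot⟩, hP⟩ := h.1 hex
    exact ⟨hbot, τ, hP⟩
  · rintro ⟨hbot, τ, hP⟩
    exact ⟨fun _ => ⟨_, .choose q τ hbot, hP⟩, fun h => (h hex).elim⟩

theorem one_mem_cpre : .one q ∈ (satGame L B).cpre P ↔
    ∃ Ξ : Set (Selection χ), (sem1 L (modalLits L B q)
      (B.lab '' ((fun κ => B.δ q (.sel κ)) '' Ξ))).Nonempty ∧ .sels q Ξ ∈ P := by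
  have hex : .one q ∈ (satGame L B).exNodes := ⟨q, .inr rfl⟩
  constructor
  · intro h
    obtain ⟨_, _ | _ | _ | ⟨_, Ξ, hΞ⟩, hP⟩ := h.1 hex
    exact ⟨Ξ, hΞ, hP⟩
  · rintro ⟨Ξ, hΞ, hP⟩
    exact ⟨fun _ => ⟨_, .select q Ξ hΞ, hP⟩, fun h => (h hex).elim⟩

theorem sels_mem_cpre {Ξ : Set (Selection χ)} : .sels q Ξ ∈ (satGame L B).cpre P ↔
    ∀ κ ∈ Ξ, .state (B.δ q (.sel κ)) ∈ P := by
  have hex : .sels q Ξ ∉ (satGame L B).exNodes := by simp [satGame]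
  refine ⟨fun h κ hκ => h.2 hex _ (.step q Ξ κ hκ), fun h => ⟨fun h' => (hex h').elim, ?_⟩⟩
  rintro - _ (_ | _ | _ | _ | ⟨_, _, κ, hκ⟩)
  exact h κ hκ

end Cpre

/-- The region of the satisfiability game from which the existential player can enforce that the
next automaton state is in `A q`, where `q` is the current one. -/
def enforcing (A : B.D → Set B.D) : Set (SatNode L B) :=
  {v | match v with
    | .state q => q ∈ propagateOp L B (A q)
    | .zero q => ¬ HasBot L B q ∧ ∃ τ : Choice χ, B.δ q (.choice τ) ∈ A q
    | .one q => (sem1 L (modalLits L B q) (B.lab '' (selSucc L B q ∩ A q))).Nonempty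
    | .sels q Ξ => ∀ κ ∈ Ξ, B.δ q (.sel κ) ∈ A q}

/-- The moves of the satisfiability game whose underlying moves between automaton states follow
`T`. -/
def satMoveAlong (T : B.D → B.D → Prop) (v v' : SatNode L B) : Prop :=
  SatMove L B v v' ∧ ∀ q', v' = .state q' → T v.origin q'

variable {Q : ℕ → Prop} {T : B.D → B.D → Prop}

theorem SatMove.origin_eq {v v' : SatNode L B} (h : SatMove L B v v')
    (hv' : ¬ ∃ q, v' = .state q) : v'.origin = v.origin := by
  cases h
  case choose | step => exact (hv' ⟨_, rfl⟩).elim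
  all_goals rfl

theorem SatMove.exists_eq_state {v₀ v₁ v₂ : SatNode L B} (h : SatMove L B v₀ v₁)
    (h' : SatMove L B v₁ v₂) :
    (∃ q, v₀ = .state q) ∨ (∃ q, v₁ = .state q) ∨ ∃ q, v₂ = .state q := by
  cases h <;> cases h' <;> simp

theorem maxInf_of_satMoveAlong (hT : ∀ p : ℕ → B.D, (∀ n, T (p n) (p (n + 1))) →
      MaxInf Q fun n => B.Ω (p n)) (x : ℕ → SatNode L B)
    (hx : ∀ n, satMoveAlong T (x n) (x (n + 1))) :
    MaxInf Q fun n => (satGame L B).priority (x n) := by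
  have priority_ne_zero : ∀ {v : SatNode L B}, (satGame L B).priority v ≠ 0 ↔
      ∃ q, v = .state q := by
    intro v
    cases v <;> simp [satGame, Nat.one_le_iff_ne_zero.1 (B.one_le_Ω _)]
  refine .of_delayed_path hT (o := fun n => (x n).origin) ?_ ?_ ?_ ?_
  · intro n hn
    obtain ⟨q, hq⟩ := priority_ne_zero.1 hn
    rw [hq]
    rfl
  · refine frequently_atTop.2 fun n => ?_
    rcases (hx n).1.exists_eq_state (hx (n + 1)).1 with h | h | h
    · exact ⟨n, le_rfl, priority_ne_zero.2 h⟩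
    · exact ⟨n + 1, by omega, priority_ne_zero.2 h⟩
    · exact ⟨n + 2, by omega, priority_ne_zero.2 h⟩
  · exact fun n hn => (hx n).1.origin_eq (mt priority_ne_zero.2 (not_not.2 hn))
  · intro n hn
    obtain ⟨q, hq⟩ := priority_ne_zero.1 hn
    simp only [hq]
    exact (hx n).2 q hq

theorem IsTrace.toSatGame {W : Set B.D} (h : IsTrace (propagateOp L B) B.Ω Q W T) :
    IsTrace (satGame L B).cpre (satGame L B).priority Q
      (enforcing fun q => {q' ∈ W | T q q'}) (satMoveAlong T) where
  step
    | .state q, hq => state_mem_cpre.2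
      ⟨⟨hq.2, .to_zero q, nofun⟩, ⟨hq.1, .to_one q, nofun⟩⟩
    | .zero q, ⟨hbot, τ, hτ⟩ => zero_mem_cpre.2 ⟨hbot, τ, h.step _ hτ.1, .choose q τ hbot, by
        rintro _ ⟨⟩
        exact hτ.2⟩
    | .one q, hq => by
      obtain ⟨Ξ, hsem, hΞ⟩ := sem1_selSucc_inter_nonempty_iff.1 hq
      exact one_mem_cpre.2 ⟨Ξ, hsem, hΞ, .select q Ξ hsem, nofun⟩
    | .sels q Ξ, hΞ => sels_mem_cpre.2 fun κ hκ => ⟨h.step _ (hΞ κ hκ).1, .step q Ξ κ hκ, by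
        rintro _ ⟨⟩
        exact (hΞ κ hκ).2⟩
  maxInf := maxInf_of_satMoveAlong h.maxInf

theorem IsTrace.toSatGame_dual {W : Set B.D} (h : IsTrace (dualOp (propagateOp L B)) B.Ω Q W T) :
    IsTrace (dualOp (satGame L B).cpre) (satGame L B).priority Q
      (enforcing fun q => {q' ∈ W | T q q'}ᶜ)ᶜ (satMoveAlong T) where
  step v hv hpre := by
    refine hv ?_
    set A : B.D → Set B.D := fun q => {q' ∈ W | T q q'}ᶜ
    have mem_of_state : ∀ {v q'}, SatMove L B v (.state q') →
        .state q' ∈ {v' ∈ (enforcing A)ᶜ | satMoveAlong T v v'}ᶜ → q' ∈ A v.origin := by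
      rintro v q' hmove hq' ⟨hW, hT⟩
      refine hq' ⟨h.step q' hW, hmove, ?_⟩
      rintro _ ⟨⟩
      exact hT
    have mem_enforcing : ∀ {v v'}, SatMove L B v v' → (¬ ∃ q, v' = .state q) →
        v' ∈ {v' ∈ (enforcing A)ᶜ | satMoveAlong T v v'}ᶜ → v' ∈ enforcing A := by
      intro v v' hmove hstate hv'
      by_contra hnot
      exact hv' ⟨hnot, hmove, fun q hq => (hstate ⟨q, hq⟩).elim⟩
    rcases v with q | q | q | ⟨q, Ξ⟩
    · obtain ⟨hzero, hone⟩ := state_mem_cpre.1 hpre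
      exact ⟨mem_enforcing (.to_one q) nofun hone, mem_enforcing (.to_zero q) nofun hzero⟩
    · obtain ⟨hbot, τ, hτ⟩ := zero_mem_cpre.1 hpre
      exact ⟨hbot, τ, mem_of_state (.choose q τ hbot) hτ⟩
    · obtain ⟨Ξ, hsem, hΞ⟩ := one_mem_cpre.1 hpre
      exact sem1_selSucc_inter_nonempty_iff.2 ⟨Ξ, hsem, mem_enforcing (.select q Ξ hsem) nofun hΞ⟩
    · exact fun κ hκ => mem_of_state (.step q Ξ κ hκ) (sels_mem_cpre.1 hpre κ hκ)
  maxInf := maxInf_of_satMoveAlong h.maxInf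

end SatGame

end CoalgMu

open CoalgMu in
theorem lemma4p7_general (L : CoalgLogic.{u}) {χ : Formula L.Λ} (B : CoDetTracking.{u, w} χ)
    (q : B.D) : q ∈ fixE L B ↔ (satGame L B).ExWinsNode (.state q) := by
  constructor
  · intro hq
    obtain ⟨T, hT⟩ := exists_isPartialTrace_nestedFix (propagateOp L B) B.one_le_Ω
      (numPriorities χ) fun _ => ∅
    have htrace : IsTrace (propagateOp L B) B.Ω Even (fixE L B) T := hT.isTrace B.Ω_le
    exact ParityGame.exWinsNode_of_isTrace htrace.toSatGame (htrace.step q hq)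
  · contrapose
    intro hq
    obtain ⟨T, hT⟩ := exists_isPartialTrace_compl_nestedFix (propagateOp L B) B.one_le_Ω
      (numPriorities χ) fun _ => ∅
    have htrace : IsTrace (dualOp (propagateOp L B)) B.Ω Odd (fixE L B)ᶜ T := hT.isTrace B.Ω_le
    exact ParityGame.not_exWinsNode_of_isTrace htrace.toSatGame_dual (htrace.step q hq)

theorem lemma4p7 (L : CoalgMu.CoalgLogic.{u}) (χ : CoalgMu.Formula L.Λ)
    (hwf : χ.WellFormed) (hclosed : χ.Closed) (hclean : χ.Clean)
    (B : CoalgMu.CoDetTracking.{u, w} χ) (q : B.D) :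
    q ∈ CoalgMu.fixE L B ↔
      (CoalgMu.satGame L B).ExWinsNode (CoalgMu.SatNode.state q) :=
  lemma4p7_general L B q
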